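/- Work in $\mathbb P^5$ over $\mathbb C$ with coordinates $\mathbf p=(p_{12},p_{13},p_{23},p_{14},p_{24},p_{34})$, and let $\mathrm{Gr}(2,4)=\{p_{12}p_{34}-p_{13}p_{24}+p_{14}p_{23}=0\}$. For real linear forms $h_1,h_2$ let $P\subset\mathbb P^5(\mathbb R)$ be the set given by $p_{ij}\ge 0$, $h_1\ge 0$, $h_2\ge 0$ (meaning that all pairwise products of these eight forms are nonnegative), and $S=P\cap\mathrm{Gr}(2,4)$. *Faces.* For a closed semialgebraic set $F\subseteq X(\mathbb R)$ in a variety $X$, let $C_1,\dots,C_r$ be the irreducible components of the Zariski closure of $F\setminus\mathrm{Int}_{X(\mathbb R)}F$; the facets of $F$ are the (nonempty) closures of the interiors of $C_i(\mathbb R)\cap F$ in $C_i(\mathbb R)$. The faces of $F$ are $F$ itself and, recursively, the facets of its faces. *Positive hexahedra.* $S$ is a positive hexahedron if $P$ is a full-dimensional polytope with exactly eight facets, lying in the hyperplanes $p_{ij}=0$, $h_1=0$, $h_2=0$; this arrangement of eight hyperplanes is simple (any six of the forms are linearly independent); and $S\subset\mathrm{Gr}(2,4)$ has exactly six facets, whose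 Zariski closures are the sections of $\mathrm{Gr}(2,4)$ by $p_{12}=0$, $p_{23}=0$, $p_{14}=0$, $p_{34}=0$, $h_1=0$, $h_2=0$. *Adjoints.* The strata of $S$ are the Zariski closures of its facets and everything obtained from them by repeatedly taking irreducible components of intersections of strata. The residual arrangement $\mathcal R(S)$ consists of the strata that contain no face of $S$. An adjoint of the positive hexahedron $S$ is a quadratic form on $\mathbb P^5$ that vanishes on $\mathcal R(S)$ and whose zero locus meets $\mathrm{Gr}(2,4)$ in codimension one. **Proposition.** For generic $h_1,h_2$ there are at most six adjoints of $S$ that are linearly independent modulo the Plücker quadric. That is, there is a nonzero real polynomial $\Phi$ in the twelve coefficients of $(h_1,h_2)$ such that, whenever $\Phi(h_1,h_2)\ne 0$ and $S$ is a positive hexahedron, every family of adjoints of $S$ that is linearly independent modulo $p_{12}p_{34}-p_{13}p_{24}+p_{14}p_{23}$ has at most six members. -/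

import Mathlib

open scoped LinearAlgebra.Projectivization

noncomputable section

namespace PosHex

/-- Complex projective space `ℙ⁵` with homogeneous (Plücker) coordinates
`(p₁₂ : p₁₃ : p₂₃ : p₁₄ : p₂₄ : p₃₄)`, indexed by `0, …, 5` in this order. -/
abbrev CP5 : Type := ℙ ℂ (Fin 6 → ℂ)

/-- Real projective space `ℙ⁵(ℝ)`. -/
abbrev RP5 : Type := ℙ ℝ (Fin 6 → ℝ)

/-- The analytic topology on `ℙ⁵(ℝ)`: the quotient topology from `ℝ⁶ ∖ {0}`. -/
instance : TopologicalSpace RP5 :=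
  TopologicalSpace.coinduced (Projectivization.mk' ℝ (V := Fin 6 → ℝ)) inferInstance

/-- Coordinatewise inclusion `ℝ⁶ → ℂ⁶`. -/
def complexify : (Fin 6 → ℝ) →ₛₗ[Complex.ofRealHom] (Fin 6 → ℂ) where
  toFun v := fun i => (v i : ℂ)
  map_add' v w := by ext i; simp
  map_smul' c v := by ext i; simp

theorem complexify_injective : Function.Injective complexify := fun v w hvw => by
  funext i
  exact Complex.ofReal_injective (congrFun hvw i)

/-- The inclusion `ℙ⁵(ℝ) → ℙ⁵(ℂ)`. -/
def toComplex : RP5 → CP5 := Projectivization.map complexify complexify_injective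

/-! ### Projective varieties -/

/-- Vanishing of a form at a point of `ℙ⁵`; independent of the representative when `f` is
homogeneous, the only case in which it is used. -/
def Vanishes (f : MvPolynomial (Fin 6) ℂ) (x : CP5) : Prop :=
  MvPolynomial.eval x.rep f = 0

/-- `Z` is the common zero set of a set of homogeneous polynomials. -/
def IsZariskiClosed (Z : Set CP5) : Prop :=
  ∃ A : Set (MvPolynomial (Fin 6) ℂ), (∀ f ∈ A, ∃ d, f.IsHomogeneous d) ∧
    Z = {x | ∀ f ∈ A, Vanishes f x}

/-- The Zariski closure of a subset of `ℙ⁵`. -/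
def zariskiClosure (T : Set CP5) : Set CP5 :=
  {x | ∀ (d : ℕ) (f : MvPolynomial (Fin 6) ℂ), f.IsHomogeneous d →
    (∀ y ∈ T, Vanishes f y) → Vanishes f x}

/-- Irreducible Zariski closed subsets of `ℙ⁵` (in particular nonempty). -/
def IsIrreducibleClosed (Z : Set CP5) : Prop :=
  IsZariskiClosed Z ∧ Z.Nonempty ∧
    ∀ Z₁ Z₂ : Set CP5, IsZariskiClosed Z₁ → IsZariskiClosed Z₂ →
      Z ⊆ Z₁ ∪ Z₂ → Z ⊆ Z₁ ∨ Z ⊆ Z₂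

/-- `C` is an irreducible component of the Zariski closed set `Z`. -/
def IsComponent (C Z : Set CP5) : Prop :=
  Maximal (fun Y => IsIrreducibleClosed Y ∧ Y ⊆ Z) C

/-- The real points of `Z ⊆ ℙ⁵(ℂ)`. -/
def realPoints (Z : Set CP5) : Set RP5 := toComplex ⁻¹' Z

/-! ### Facets and faces of a semialgebraic set

`X` is a variety, `F ⊆ X(ℝ)` a closed semialgebraic set. -/

/-- The interior of `F` in the subspace `X(ℝ)`. -/
def relInterior (X : Set CP5) (F : Set RP5) : Set RP5 :=
  {x ∈ realPoints X | ∃ U : Set RP5, IsOpen U ∧ x ∈ U ∧ U ∩ realPoints X ⊆ F}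

/-- The algebraic boundary: the Zariski closure of `F` minus its interior in `X(ℝ)`. -/
def algBoundary (X : Set CP5) (F : Set RP5) : Set CP5 :=
  zariskiClosure (toComplex '' (F \ relInterior X F))

/-- `G` is the facet of `F ⊆ X(ℝ)` belonging to the irreducible component `C` of the algebraic
boundary: the closure, in `C(ℝ)`, of the interior of `C(ℝ) ∩ F` in `C(ℝ)`. -/
def IsFacet (X : Set CP5) (F : Set RP5) (C : Set CP5) (G : Set RP5) : Prop :=
  IsComponent C (algBoundary X F) ∧
    G = closure (relInterior C (realPoints C ∩ F)) ∩ realPoints C ∧ G.Nonempty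

/-- The faces of `F ⊆ X(ℝ)`, each listed with the variety in which it is full-dimensional:
`F` itself and, recursively, the facets of faces. -/
inductive IsFace (X : Set CP5) (F : Set RP5) : Set CP5 → Set RP5 → Prop
  | self : IsFace X F X F
  | step (C : Set CP5) (G : Set RP5) (C' : Set CP5) (G' : Set RP5) :
      IsFace X F C G → IsFacet C G C' G' → IsFace X F C' G'

/-- The set of Zariski closures of the facets of `F`. -/
def facetClosures (X : Set CP5) (F : Set RP5) : Set (Set CP5) :=
  {Z | ∃ C G, IsFacet X F C G ∧ Z = zariskiClosure (toComplex '' G)}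

/-- The strata cut out by the facets: the Zariski closures of the facets and, repeatedly, all
irreducible components of intersections of strata. -/
inductive IsStratum (X : Set CP5) (F : Set RP5) : Set CP5 → Prop
  | facet (Z : Set CP5) : Z ∈ facetClosures X F → IsStratum X F Z
  | inter (Y₁ Y₂ Y : Set CP5) :
      IsStratum X F Y₁ → IsStratum X F Y₂ → IsComponent Y (Y₁ ∩ Y₂) → IsStratum X F Y

/-- The residual arrangement: the strata that contain no face. -/
def residualArrangement (X : Set CP5) (F : Set RP5) : Set (Set CP5) :=
  {Y | IsStratum X F Y ∧ ∀ C G, IsFace X F C G → ¬ toComplex '' G ⊆ Y}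

/-! ### Positive hexahedra in `Gr(2,4)` -/

/-- The Plücker quadric `p₁₂ p₃₄ - p₁₃ p₂₄ + p₁₄ p₂₃`. -/
def pluecker : MvPolynomial (Fin 6) ℂ :=
  MvPolynomial.X 0 * MvPolynomial.X 5 - MvPolynomial.X 1 * MvPolynomial.X 4
    + MvPolynomial.X 3 * MvPolynomial.X 2

/-- `Gr(2,4) ⊆ ℙ⁵`. -/
def Gr : Set CP5 := {x | Vanishes pluecker x}

/-- The complex hyperplane with the real coefficient vector `l`. -/
def hyperplane (l : Fin 6 → ℝ) : Set CP5 := {x | complexify l ⬝ᵥ x.rep = 0}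

/-- The eight linear forms: the six coordinates, then `h₁` and `h₂`, as coefficient vectors. -/
def forms (h : Fin 2 → Fin 6 → ℝ) : Fin 6 ⊕ Fin 2 → Fin 6 → ℝ :=
  Sum.elim (fun i => Pi.single i 1) h

/-- The subset of `ℙ⁵(ℝ)` given by `p_{ij} ≥ 0`, `h₁ ≥ 0`, `h₂ ≥ 0`; for a system of linear
inequalities in projective space this means that all pairwise products are nonnegative. -/
def polytope (h : Fin 2 → Fin 6 → ℝ) : Set RP5 :=
  {x | ∀ i j, 0 ≤ (forms h i ⬝ᵥ x.rep) * (forms h j ⬝ᵥ x.rep)}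

/-- `S = P ∩ Gr(2,4)`. -/
def hexahedron (h : Fin 2 → Fin 6 → ℝ) : Set RP5 := polytope h ∩ realPoints Gr

/-- `S = P ∩ Gr(2,4)` is a positive hexahedron: `P` is a full-dimensional polytope with exactly
the eight facets cut out by the six coordinates and `h₁, h₂`, its hyperplane arrangement is simple
(any six of the eight forms are independent), and the facets of `S` are the six given by
`p₁₂, p₂₃, p₁₄, p₃₄, h₁, h₂` (all indices but those of `p₁₃` and `p₂₄`). The set `P` lies in the
affine chart in which the sum of the coordinates is nonzero. -/
structure IsPositiveHexahedron (h : Fin 2 → Fin 6 → ℝ) : Prop where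
  full_dim : (interior (polytope h)).Nonempty
  polytope_facets :
    facetClosures Set.univ (polytope h) = Set.range fun i => hyperplane (forms h i)
  simple : ∀ s : Finset (Fin 6 ⊕ Fin 2), s.card = 6 →
    LinearIndependent ℝ fun i : s => forms h i
  facets : facetClosures Gr (hexahedron h) =
    (fun i => Gr ∩ hyperplane (forms h i)) '' {i | i ≠ Sum.inl 1 ∧ i ≠ Sum.inl 4}

/-- `a` is an adjoint polynomial of the positive hexahedron `S`: a quadratic form vanishing on the
residual arrangement of `S` whose hypersurface meets `Gr(2,4)` in codimension one, that is (as
`Gr(2,4)` is irreducible), does not contain `Gr(2,4)`. -/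
def IsAdjoint (h : Fin 2 → Fin 6 → ℝ) (a : MvPolynomial (Fin 6) ℂ) : Prop :=
  a.IsHomogeneous 2 ∧
    (∀ Y ∈ residualArrangement Gr (hexahedron h), ∀ x ∈ Y, Vanishes a x) ∧
    ¬ Gr ⊆ {x | Vanishes a x}

end PosHex

end

noncomputable section

namespace PosHex

open scoped Matrix Pointwise

/-! The coordinate points of `ℙ⁵` form an octahedron whose opposite vertices are the three pairs
multiplied in the Plücker quadric. Each triangle of the octahedron spans a plane inside `Gr(2,4)`,
and this plane is a stratum (`IsPositiveHexahedron.isStratum_triangle`). Its three edges and its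
sections by `h₁`, `h₂` are five real lines, in general position for generic `h`. Their ten
intersection points are strata too, and those outside the polytope are residual, so every adjoint
vanishes there (`IsAdjoint.eval_point_eq_zero`).

The conics through these residual points form a space of dimension at most one
(`exists_point_determining_conic`): one more linear condition makes an adjoint vanish on the whole
plane. Four alternate triangles contain all twelve edges of the octahedron, so four conditions leave
only combinations of `p₁₂p₃₄`, `p₁₃p₂₄`, `p₁₄p₂₃`. Modulo the Plücker quadric these need two further
conditions (`mem_span_pluecker`), and `4 + 2 = 6`. -/

/-! ### Five lines in the plane -/

/-- The triple product of three vectors. -/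
def triple (u v w : Fin 3 → ℝ) : ℝ := u ⬝ᵥ (v ⨯₃ w)

theorem triple_eq (u v w : Fin 3 → ℝ) : triple u v w =
    u 0 * (v 1 * w 2 - v 2 * w 1) + u 1 * (v 2 * w 0 - v 0 * w 2)
      + u 2 * (v 0 * w 1 - v 1 * w 0) := by
  simp [triple, cross_apply, dotProduct, Fin.sum_univ_three]

/-- Up to signs and the factor `triple u v w`, the three pairwise cross products are the basis dual
to `u`, `v`, `w`. -/
theorem triple_smul_expand (u v w x : Fin 3 → ℝ) : triple u v w • x =
    (w ⬝ᵥ x) • (u ⨯₃ v) - (v ⬝ᵥ x) • (u ⨯₃ w) + (u ⬝ᵥ x) • (v ⨯₃ w) := by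
  ext i
  fin_cases i <;>
    simp [triple_eq, cross_apply, dotProduct, Fin.sum_univ_three] <;> ring

theorem triple_smul_cross (u v w z : Fin 3 → ℝ) : triple u v w • (u ⨯₃ z) =
    triple u z w • (u ⨯₃ v) + triple u v z • (u ⨯₃ w) := by
  ext i
  fin_cases i <;> simp [triple_eq, cross_apply] <;> ring

/-- The intersection point of the lines `L i` and `L j` satisfies, up to a common sign, all the
inequalities given by the lines `L k`. -/
def IsAlive {ι : Type*} (L : ι → Fin 3 → ℝ) (i j : ι) : Prop :=
  ∀ k l, 0 ≤ triple (L k) (L i) (L j) * triple (L l) (L i) (L j)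

/-- Any three of the lines `L k` have no common point. -/
def InGeneralPosition {ι : Type*} (L : ι → Fin 3 → ℝ) : Prop :=
  ∀ i j k, i ≠ j → i ≠ k → j ≠ k → triple (L i) (L j) (L k) ≠ 0

section Lines

variable {ι : Type*} {L : ι → Fin 3 → ℝ}

theorem triple_swap (u v w : Fin 3 → ℝ) : triple u w v = -triple u v w := by
  simp only [triple_eq]; ring

theorem IsAlive.symm {i j : ι} (h : IsAlive L i j) : IsAlive L j i := fun k l => by
  rw [triple_swap (L k), triple_swap (L l), neg_mul_neg]
  exact h k l

/-- At most two of the points on a line are alive. -/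
theorem not_alive_of_collinear (hL : InGeneralPosition L) {i j k l : ι} (hij : i ≠ j)
    (hik : i ≠ k) (hil : i ≠ l) (hjk : j ≠ k) (hjl : j ≠ l) (hkl : k ≠ l)
    (h₁ : IsAlive L i j) (h₂ : IsAlive L i k) (h₃ : IsAlive L i l) : False := by
  have n₁ := hL i j k hij hik hjk
  have n₂ := hL i j l hij hil hjl
  have n₃ := hL i k l hik hil hkl
  have a₁ : 0 ≤ triple (L i) (L j) (L k) * triple (L i) (L j) (L l) := by
    have := h₁ k l
    simp only [triple_eq] at this ⊢
    linear_combination this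
  have a₂ : triple (L i) (L j) (L k) * triple (L i) (L k) (L l) ≤ 0 := by
    have := h₂ j l
    simp only [triple_eq] at this ⊢
    linear_combination this
  have a₃ : 0 ≤ triple (L i) (L j) (L l) * triple (L i) (L k) (L l) := by
    have := h₃ j k
    simp only [triple_eq] at this ⊢
    linear_combination this
  have b₁ := lt_of_le_of_ne a₁ (mul_ne_zero n₁ n₂).symm
  have b₂ := lt_of_le_of_ne a₂ (mul_ne_zero n₁ n₃)
  have b₃ := lt_of_le_of_ne a₃ (mul_ne_zero n₂ n₃).symm
  -- The product of the three quantities is a square, yet it would be negative.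
  have := mul_neg_of_pos_of_neg (mul_pos b₁ b₃) b₂
  nlinarith [sq_nonneg (triple (L i) (L j) (L k) * triple (L i) (L j) (L l)
    * triple (L i) (L k) (L l))]

/-- If three lines bound a triangle with alive vertices, then the intersection of two further
lines is not alive. -/
theorem not_alive_of_triangle (hL : InGeneralPosition L) {i j k l m : ι} (hij : i ≠ j)
    (hik : i ≠ k) (hil : i ≠ l) (him : i ≠ m) (hjk : j ≠ k) (hkl : k ≠ l) (hkm : k ≠ m)
    (hlm : l ≠ m) (h₁ : IsAlive L k l) (h₂ : IsAlive L k m) (h₃ : IsAlive L l m)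
    (h₀ : IsAlive L i j) : False := by
  have n₀ := hL k l m hkl hkm hlm
  have n₁ := hL i j k hij hik hjk
  have n₂ := hL i l m hil him hlm
  -- A Grassmann–Plücker relation. Geometrically, line `i` does not separate the vertices of the
  -- triangle, while its point on line `j` lies in the triangle. After multiplication by `triple (L
  -- k) (L l) (L m) * triple (L i) (L j) (L k)` all three terms are nonnegative and the first is
  -- positive.
  have key : triple (L i) (L l) (L m) * triple (L i) (L j) (L k)
      - triple (L i) (L k) (L m) * triple (L i) (L j) (L l)
      + triple (L i) (L k) (L l) * triple (L i) (L j) (L m) = 0 := by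
    simp only [triple_eq]; ring
  have c₁ : 0 ≤ triple (L k) (L l) (L m) * triple (L i) (L k) (L l) := by
    have := h₁ m i
    simp only [triple_eq] at this ⊢
    linear_combination this
  have c₂ : triple (L k) (L l) (L m) * triple (L i) (L k) (L m) ≤ 0 := by
    have := h₂ l i
    simp only [triple_eq] at this ⊢
    linear_combination this
  have c₃ : 0 ≤ triple (L k) (L l) (L m) * triple (L i) (L l) (L m) := h₃ k i
  have d₂ : 0 ≤ triple (L i) (L j) (L k) * triple (L i) (L j) (L l) := by
    have := h₀ k l
    simp only [triple_eq] at this ⊢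
    linear_combination this
  have d₃ : 0 ≤ triple (L i) (L j) (L k) * triple (L i) (L j) (L m) := by
    have := h₀ k m
    simp only [triple_eq] at this ⊢
    linear_combination this
  generalize triple (L k) (L l) (L m) = s at *
  generalize triple (L i) (L j) (L k) = t at *
  generalize triple (L i) (L l) (L m) = x at *
  generalize triple (L i) (L k) (L m) = y at *
  generalize triple (L i) (L k) (L l) = z at *
  have e₂ := mul_nonneg (neg_nonneg.2 c₂) d₂
  have e₃ := mul_nonneg c₁ d₃
  have e₁ : 0 < s * x * (t * t) :=
    mul_pos (lt_of_le_of_ne c₃ (mul_ne_zero n₀ n₂).symm) (mul_self_pos.2 n₁)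
  have : s * t * (x * t - y * triple (L i) (L j) (L l) + z * triple (L i) (L j) (L m)) = 0 := by
    rw [key, mul_zero]
  linarith

end Lines

/-! ### Conics through the intersection points -/

section Conics

variable {Q : QuadraticMap ℝ (Fin 3 → ℝ) ℂ}

/-- A binary quadratic form with three distinct zeros vanishes: expanding `Q` at the third point, a
combination of the other two with nonzero coefficients, leaves only the polar term. -/
theorem polar_eq_zero_of_collinear {u v w z : Fin 3 → ℝ} (h₂ : triple u v z ≠ 0)
    (h₃ : triple u z w ≠ 0) (hv : Q (u ⨯₃ v) = 0) (hw : Q (u ⨯₃ w) = 0)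
    (hz : Q (u ⨯₃ z) = 0) : QuadraticMap.polar Q (u ⨯₃ v) (u ⨯₃ w) = 0 := by
  have h := congrArg Q (triple_smul_cross u v w z)
  simp only [QuadraticMap.map_smul, QuadraticMap.map_add, hv, hw, hz, smul_zero, zero_add,
    QuadraticMap.polar_smul_left, QuadraticMap.polar_smul_right] at h
  simpa [h₂, h₃] using h.symm

/-- A conic containing the lines `u`, `v`, and a point on neither of them, is zero. -/
theorem eq_zero_of_two_lines {u v w r : Fin 3 → ℝ} (hD : triple u v w ≠ 0)
    (huv : Q (u ⨯₃ v) = 0) (huw : Q (u ⨯₃ w) = 0) (hvw : Q (v ⨯₃ w) = 0)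
    (hu : QuadraticMap.polar Q (u ⨯₃ v) (u ⨯₃ w) = 0)
    (hv : QuadraticMap.polar Q (u ⨯₃ v) (v ⨯₃ w) = 0)
    (hur : u ⬝ᵥ r ≠ 0) (hvr : v ⬝ᵥ r ≠ 0) (hr : Q r = 0) (x : Fin 3 → ℝ) : Q x = 0 := by
  -- In the dual basis only one coefficient of `Q` survives, so `Q` is a multiple of the product of
  -- the two lines; the point `r` then kills that multiple.
  have key (x : Fin 3 → ℝ) : (triple u v w * triple u v w) • Q x =
      -((v ⬝ᵥ x) • (u ⬝ᵥ x) • QuadraticMap.polar Q (u ⨯₃ w) (v ⨯₃ w)) := by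
    rw [← QuadraticMap.map_smul, triple_smul_expand, sub_eq_add_neg, ← neg_smul]
    simp only [QuadraticMap.map_smul, QuadraticMap.map_add, huv, huw, hvw, hu, hv, smul_zero,
      zero_add, add_zero, QuadraticMap.polar_smul_left, QuadraticMap.polar_smul_right,
      QuadraticMap.polar_add_left]
    rw [neg_smul, smul_neg, smul_comm]
  have hc : QuadraticMap.polar Q (u ⨯₃ w) (v ⨯₃ w) = 0 := by
    have := key r
    rw [hr, smul_zero, eq_comm, neg_eq_zero] at this
    simpa [hur, hvr] using this
  have := key x
  rw [hc] at this
  simpa [hD] using this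

variable {L : Fin 5 → Fin 3 → ℝ}

/-- If the conic vanishes at `L i ⨯ L j` and at every intersection point that is not alive, then
it vanishes on the line `L i`. -/
theorem eq_zero_on_line (hL : InGeneralPosition L)
    (hQ : ∀ i j, i ≠ j → ¬ IsAlive L i j → Q (L i ⨯₃ L j) = 0) {i j k l m : Fin 5}
    (hij : i ≠ j) (hik : i ≠ k) (hil : i ≠ l) (him : i ≠ m) (hjk : j ≠ k) (hjl : j ≠ l)
    (hjm : j ≠ m) (hkl : k ≠ l) (hkm : k ≠ m) (hlm : l ≠ m)
    (halive : IsAlive L i j ∨ ∀ k, i ≠ k → ¬ IsAlive L i k) (h₀ : Q (L i ⨯₃ L j) = 0) :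
    Q (L i ⨯₃ L k) = 0 ∧ QuadraticMap.polar Q (L i ⨯₃ L j) (L i ⨯₃ L k) = 0 := by
  -- At most two points of a line are alive, so beside the point on `L j` at most one more is.
  have two {a b : Fin 5} (hia : i ≠ a) (hib : i ≠ b) (hja : j ≠ a) (hjb : j ≠ b) (hab : a ≠ b) :
      Q (L i ⨯₃ L a) = 0 ∨ Q (L i ⨯₃ L b) = 0 := by
    by_contra! hne
    have ha : IsAlive L i a := by_contra fun h => hne.1 (hQ i a hia h)
    have hb : IsAlive L i b := by_contra fun h => hne.2 (hQ i b hib h)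
    rcases halive with h | h
    · exact not_alive_of_collinear hL hij hia hib hja hjb hab h ha hb
    · exact h a hia ha
  by_cases hk : Q (L i ⨯₃ L k) = 0
  · refine ⟨hk, ?_⟩
    rcases two hil him hjl hjm hlm with hl | hm
    · exact polar_eq_zero_of_collinear (hL i j l hij hil hjl) (hL i l k hil hik hkl.symm) h₀ hk hl
    · exact polar_eq_zero_of_collinear (hL i j m hij him hjm) (hL i m k him hik hkm.symm) h₀ hk hm
  · exfalso
    have hl := (two hik hil hjk hjl hkl).resolve_left hk
    have hm := (two hik him hjk hjm hkm).resolve_left hk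
    -- Zeros at the other three points make `Q` vanish on the whole line, hence also at the point on
    -- `L k`.
    have hp := polar_eq_zero_of_collinear (hL i j m hij him hjm) (hL i m l him hil hlm.symm) h₀ hl hm
    have h := congrArg Q (triple_smul_cross (L i) (L j) (L l) (L k))
    simp only [QuadraticMap.map_smul, QuadraticMap.map_add, h₀, hl, hp, smul_zero, zero_add,
      QuadraticMap.polar_smul_left, QuadraticMap.polar_smul_right] at h
    simp [hL i j l hij hil hjl, hk] at h

/-- Conics through all the intersection points of five general lines that are not vertices of the
polygon bounded by the lines form a space of dimension at most one. -/
theorem exists_point_determining_conic (hL : InGeneralPosition L) :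
    ∃ p : Fin 3 → ℝ, ∀ Q : QuadraticMap ℝ (Fin 3 → ℝ) ℂ,
      (∀ i j, i ≠ j → ¬ IsAlive L i j → Q (L i ⨯₃ L j) = 0) → Q p = 0 → ∀ x, Q x = 0 := by
  obtain ⟨i, j, hij, halive⟩ : ∃ i j : Fin 5, i ≠ j ∧
      (IsAlive L i j ∨ ∀ k l, k ≠ l → ¬ IsAlive L k l) := by
    by_cases h : ∃ i j, i ≠ j ∧ IsAlive L i j
    · obtain ⟨i, j, hij, h⟩ := h
      exact ⟨i, j, hij, .inl h⟩
    · push Not at h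
      exact ⟨0, 1, by decide, .inr h⟩
  obtain ⟨k, l, m, ⟨hik, hil, him⟩, ⟨hjk, hjl, hjm⟩, hkl, hkm, hlm⟩ : ∃ k l m : Fin 5,
      (i ≠ k ∧ i ≠ l ∧ i ≠ m) ∧ (j ≠ k ∧ j ≠ l ∧ j ≠ m) ∧ k ≠ l ∧ k ≠ m ∧ l ≠ m := by
    clear halive
    revert i j
    decide
  -- The chosen point is alive if any is; vanishing there forces `Q` to vanish on both lines `L i`
  -- and `L j`.
  refine ⟨L i ⨯₃ L j, fun Q hQ h₀ => ?_⟩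
  have h₀' : Q (L j ⨯₃ L i) = 0 := by rw [← cross_anticomm, QuadraticMap.map_neg, h₀]
  obtain ⟨hu, hu'⟩ := eq_zero_on_line hL hQ hij hik hil him hjk hjl hjm hkl hkm hlm
    (halive.imp_right fun h k => h i k) h₀
  obtain ⟨hv, hv'⟩ := eq_zero_on_line hL hQ hij.symm hjk hjl hjm hik hil him hkl hkm hlm
    (halive.imp IsAlive.symm fun h k => h j k) h₀'
  rw [← cross_anticomm, QuadraticMap.polar_neg_left, neg_eq_zero] at hv'
  have finish {a b : Fin 5} (hab : a ≠ b) (hia : i ≠ a) (hib : i ≠ b) (hja : j ≠ a) (hjb : j ≠ b)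
      (h : ¬ IsAlive L a b) : ∀ x, Q x = 0 :=
    eq_zero_of_two_lines (hL i j k hij hik hjk) h₀ hu hv hu' hv'
      (hL i a b hia hib hab) (hL j a b hja hjb hab) (hQ a b hab h)
  -- A vertex of the triangle of the remaining three lines that is not alive lies off `L i` and `L
  -- j` and forces `Q = 0`. The three vertices cannot all be alive.
  by_cases h₁ : IsAlive L k l
  · by_cases h₂ : IsAlive L k m
    · by_cases h₃ : IsAlive L l m
      · rcases halive with h | h
        · exact (not_alive_of_triangle hL hij hik hil him hjk hkl hkm hlm h₁ h₂ h₃ h).elim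
        · exact (h k l hkl h₁).elim
      · exact finish hlm hil him hjl hjm h₃
    · exact finish hkm hik him hjk hjm h₂
  · exact finish hkl hik hil hjk hjl h₁

end Conics

/-! ### Projective linear subspaces -/

theorem vanishes_mk {f : MvPolynomial (Fin 6) ℂ} {d : ℕ} (hf : f.IsHomogeneous d)
    {v : Fin 6 → ℂ} (hv : v ≠ 0) :
    Vanishes f (Projectivization.mk ℂ v hv) ↔ MvPolynomial.eval v f = 0 := by
  obtain ⟨c, hc⟩ := Projectivization.exists_smul_eq_mk_rep ℂ v hv
  have h : MvPolynomial.eval ((c : ℂ) • v) f = (c : ℂ) ^ d * MvPolynomial.eval v f := by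
    rw [MvPolynomial.eval_eq', MvPolynomial.eval_eq', Finset.mul_sum]
    refine Finset.sum_congr rfl fun e he => ?_
    have hd : ∑ i, e i = d := by
      rw [← hf (MvPolynomial.mem_support_iff.1 he)]
      simp [Finsupp.weight_apply, Finsupp.sum_fintype]
    simp only [Pi.smul_apply, smul_eq_mul, mul_pow, Finset.prod_mul_distrib,
      Finset.prod_pow_eq_pow_sum, hd]
    ring
  rw [Vanishes, ← hc, Units.smul_def, h]
  simp

/-- The projectivization of a linear subspace of `ℂ⁶`. -/
def projSet (W : Submodule ℂ (Fin 6 → ℂ)) : Set CP5 := {x | x.rep ∈ W}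

theorem mk_mem_projSet {W : Submodule ℂ (Fin 6 → ℂ)} {v : Fin 6 → ℂ} (hv : v ≠ 0) :
    Projectivization.mk ℂ v hv ∈ projSet W ↔ v ∈ W := by
  obtain ⟨c, hc⟩ := Projectivization.exists_smul_eq_mk_rep ℂ v hv
  rw [projSet, Set.mem_ofPred_eq, ← hc]
  exact W.smul_mem_iff_of_isUnit c.isUnit

theorem projSet_inf (W₁ W₂ : Submodule ℂ (Fin 6 → ℂ)) :
    projSet (W₁ ⊓ W₂) = projSet W₁ ∩ projSet W₂ := rfl

theorem projSet_subset_iff {W₁ W₂ : Submodule ℂ (Fin 6 → ℂ)} :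
    projSet W₁ ⊆ projSet W₂ ↔ W₁ ≤ W₂ := by
  refine ⟨fun h v hv => ?_, fun h x hx => h hx⟩
  by_cases h0 : v = 0
  · simp [h0]
  · exact (mk_mem_projSet h0).1 (h ((mk_mem_projSet h0).2 hv))

theorem isZariskiClosed_projSet (W : Submodule ℂ (Fin 6 → ℂ)) : IsZariskiClosed (projSet W) := by
  refine ⟨{f | f.IsHomogeneous 1 ∧ ∀ w ∈ W, MvPolynomial.eval w f = 0},
    fun f hf => ⟨1, hf.1⟩, Set.Subset.antisymm (fun x hx f hf => hf.2 _ hx) fun x hx => ?_⟩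
  by_contra hxW
  obtain ⟨φ, hφx, hφ⟩ := Submodule.exists_le_ker_of_notMem (p := W) (v := x.rep) hxW
  have key (w : Fin 6 → ℂ) : MvPolynomial.eval w
      (∑ i, MvPolynomial.C (φ (Pi.single i 1)) * MvPolynomial.X i) = φ w := by
    conv_rhs => rw [pi_eq_sum_univ' w]
    simp [map_sum, mul_comm]
  refine hφx ?_
  rw [← key]
  refine hx _ ⟨?_, fun w hw => by rw [key]; exact hφ hw⟩
  refine MvPolynomial.IsHomogeneous.sum _ _ _ fun i _ => ?_
  simpa using (MvPolynomial.isHomogeneous_C (Fin 6) (φ (Pi.single i 1))).mul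
    (MvPolynomial.isHomogeneous_X ℂ i)

theorem exists_polynomial_on_line (f : MvPolynomial (Fin 6) ℂ) (v w : Fin 6 → ℂ) :
    ∃ g : Polynomial ℂ, ∀ t, g.eval t = MvPolynomial.eval (v + t • (w - v)) f := by
  refine ⟨MvPolynomial.aeval
    (fun i => Polynomial.C (v i) + Polynomial.X * Polynomial.C (w i - v i)) f, fun t => ?_⟩
  rw [← Polynomial.coe_evalRingHom, MvPolynomial.aeval_def, MvPolynomial.hom_eval₂,
    MvPolynomial.eval, MvPolynomial.coe_eval₂Hom]
  congr 1
  · ext; simp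
  · ext; simp

/-- Join a point outside one closed set to a point outside the other by a line in `W`. The two
witnessing forms restrict to nonzero polynomials in one parameter, so some point of the line avoids
both sets. -/
theorem isIrreducibleClosed_projSet {W : Submodule ℂ (Fin 6 → ℂ)} (hW : W ≠ ⊥) :
    IsIrreducibleClosed (projSet W) := by
  refine ⟨isZariskiClosed_projSet W, ?_, ?_⟩
  · obtain ⟨v, hv, h0⟩ := W.ne_bot_iff.1 hW
    exact ⟨_, (mk_mem_projSet h0).2 hv⟩
  · rintro _ _ ⟨A₁, hA₁, rfl⟩ ⟨A₂, hA₂, rfl⟩ hsub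
    by_contra! hne
    obtain ⟨h₁, h₂⟩ := hne
    obtain ⟨x, hx, hx'⟩ := Set.not_subset.1 h₁
    obtain ⟨y, hy, hy'⟩ := Set.not_subset.1 h₂
    simp only [Set.mem_ofPred_eq, not_forall] at hx' hy'
    obtain ⟨f₁, hf₁, hx'⟩ := hx'
    obtain ⟨f₂, hf₂, hy'⟩ := hy'
    obtain ⟨i, hi⟩ := Function.ne_iff.1 x.rep_nonzero
    obtain ⟨g₁, hg₁⟩ := exists_polynomial_on_line f₁ x.rep y.rep
    obtain ⟨g₂, hg₂⟩ := exists_polynomial_on_line f₂ x.rep y.rep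
    -- The third polynomial, a coordinate nonzero at `x`, keeps the chosen vector nonzero.
    obtain ⟨g₃, hg₃⟩ := exists_polynomial_on_line (MvPolynomial.X i) x.rep y.rep
    have n₁ : g₁ ≠ 0 := by
      rintro rfl
      exact hx' (by simpa [Vanishes] using (hg₁ 0).symm)
    have n₂ : g₂ ≠ 0 := by
      rintro rfl
      exact hy' (by simpa [Vanishes] using (hg₂ 1).symm)
    have n₃ : g₃ ≠ 0 := by
      rintro rfl
      exact hi (by simpa using (hg₃ 0).symm)
    obtain ⟨t, ht⟩ : ∃ t, (g₁ * g₂ * g₃).eval t ≠ 0 := by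
      by_contra! h
      exact mul_ne_zero (mul_ne_zero n₁ n₂) n₃ (Polynomial.funext fun t => by simpa using h t)
    simp only [Polynomial.eval_mul, hg₁, hg₂, hg₃, mul_ne_zero_iff] at ht
    have hz : x.rep + t • (y.rep - x.rep) ≠ 0 := fun h0 => ht.2 (by rw [h0]; simp)
    have hzW : x.rep + t • (y.rep - x.rep) ∈ W :=
      W.add_mem hx (W.smul_mem t (W.sub_mem hy hx))
    obtain ⟨d₁, hd₁⟩ := hA₁ f₁ hf₁
    obtain ⟨d₂, hd₂⟩ := hA₂ f₂ hf₂
    rcases hsub ((mk_mem_projSet hz).2 hzW) with h | h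
    · exact ht.1.1 ((vanishes_mk hd₁ hz).1 (h f₁ hf₁))
    · exact ht.1.2 ((vanishes_mk hd₂ hz).1 (h f₂ hf₂))

theorem isComponent_projSet {W : Submodule ℂ (Fin 6 → ℂ)} (hW : W ≠ ⊥) :
    IsComponent (projSet W) (projSet W) :=
  ⟨⟨isIrreducibleClosed_projSet hW, le_rfl⟩, fun _ hY _ => hY.2⟩

theorem isComponent_projSet_union {W₁ W₂ : Submodule ℂ (Fin 6 → ℂ)} (h : ¬ W₁ ≤ W₂) :
    IsComponent (projSet W₁) (projSet W₁ ∪ projSet W₂) := by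
  have hW : W₁ ≠ ⊥ := fun h0 => h (h0 ▸ bot_le)
  refine ⟨⟨isIrreducibleClosed_projSet hW, Set.subset_union_left⟩, fun Y hY hle => ?_⟩
  rcases hY.1.2.2 _ _ (isZariskiClosed_projSet W₁) (isZariskiClosed_projSet W₂) hY.2 with h' | h'
  · exact h'
  · exact (h (projSet_subset_iff.1 (hle.trans h'))).elim

theorem IsStratum.projSet_inf {X : Set CP5} {F : Set RP5} {W₁ W₂ : Submodule ℂ (Fin 6 → ℂ)}
    (h₁ : IsStratum X F (projSet W₁)) (h₂ : IsStratum X F (projSet W₂)) (h : W₁ ⊓ W₂ ≠ ⊥) :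
    IsStratum X F (projSet (W₁ ⊓ W₂)) :=
  .inter _ _ _ h₁ h₂ (isComponent_projSet h)

/-! ### Real points and faces -/

theorem toComplex_mem_projSet {W : Submodule ℂ (Fin 6 → ℂ)} {x : RP5} :
    toComplex x ∈ projSet W ↔ complexify x.rep ∈ W := by
  conv_lhs => rw [← x.mk_rep, toComplex, Projectivization.map_mk]
  exact mk_mem_projSet _

theorem pluecker_isHomogeneous : pluecker.IsHomogeneous 2 := by
  have h (i j : Fin 6) := (MvPolynomial.isHomogeneous_X ℂ i).mul (MvPolynomial.isHomogeneous_X ℂ j)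
  exact ((h 0 5).sub (h 1 4)).add (h 3 2)

theorem isClosed_polytope (h : Fin 2 → Fin 6 → ℝ) : IsClosed (polytope h) := by
  rw [isClosed_coinduced]
  have : Projectivization.mk' ℝ (V := Fin 6 → ℝ) ⁻¹' polytope h =
      {v | ∀ i j, 0 ≤ (forms h i ⬝ᵥ v.1) * (forms h j ⬝ᵥ v.1)} := by
    ext v
    obtain ⟨c, hc⟩ := Projectivization.exists_smul_eq_mk_rep ℝ v.1 v.2
    simp only [Set.mem_preimage, polytope, Set.mem_ofPred_eq, Projectivization.mk'_eq_mk, ← hc,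
      Units.smul_def, dotProduct_smul, smul_eq_mul]
    refine forall₂_congr fun i j => ?_
    rw [mul_mul_mul_comm]
    exact mul_nonneg_iff_of_pos_left (mul_self_pos.2 c.ne_zero)
  rw [this]
  simp only [Set.ofPred_forall]
  refine isClosed_iInter fun i => isClosed_iInter fun j => isClosed_le continuous_const ?_
  have hc : Continuous fun v : Fin 6 → ℝ => (forms h i ⬝ᵥ v) * (forms h j ⬝ᵥ v) := by
    unfold dotProduct
    fun_prop
  exact hc.comp continuous_subtype_val

theorem isClosed_realPoints_Gr : IsClosed (realPoints Gr) := by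
  rw [isClosed_coinduced]
  have : Projectivization.mk' ℝ (V := Fin 6 → ℝ) ⁻¹' realPoints Gr =
      {v | MvPolynomial.eval (complexify v.1) pluecker = 0} := by
    ext v
    exact vanishes_mk pluecker_isHomogeneous _
  rw [this]
  refine isClosed_eq ?_ continuous_const
  have hc : Continuous fun v : Fin 6 → ℝ => MvPolynomial.eval (complexify v) pluecker := by
    simp only [pluecker, map_add, map_sub, map_mul, MvPolynomial.eval_X, complexify,
      LinearMap.coe_mk, AddHom.coe_mk]
    fun_prop
  exact hc.comp continuous_subtype_val

/-- Facets are defined by closures, so closedness keeps all faces inside `S`; hence strata missing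
`S` are residual. -/
theorem isClosed_hexahedron (h : Fin 2 → Fin 6 → ℝ) : IsClosed (hexahedron h) :=
  (isClosed_polytope h).inter isClosed_realPoints_Gr

theorem relInterior_subset (X : Set CP5) (F : Set RP5) : relInterior X F ⊆ F :=
  fun _ ⟨hx, _, _, hxU, hU⟩ => hU ⟨hxU, hx⟩

theorem IsFacet.subset_closure {X C : Set CP5} {F G : Set RP5} (h : IsFacet X F C G) :
    G ⊆ closure F := by
  rw [h.2.1]
  exact Set.inter_subset_left.trans
    (closure_mono ((relInterior_subset _ _).trans Set.inter_subset_right))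

theorem IsFacet.nonempty_left {X C : Set CP5} {F G : Set RP5} (h : IsFacet X F C G) :
    F.Nonempty :=
  closure_nonempty_iff.1 (h.2.2.mono h.subset_closure)

theorem IsFace.subset {X C : Set CP5} {F G : Set RP5} (hF : IsClosed F) (h : IsFace X F C G) :
    G ⊆ F := by
  induction h with
  | self => exact subset_rfl
  | step C G C' G' _ hG ih => exact hG.subset_closure.trans (hF.closure_subset_iff.2 ih)

theorem IsFace.nonempty {X C : Set CP5} {F G : Set RP5} (hF : F.Nonempty) (h : IsFace X F C G) :
    G.Nonempty := by
  cases h with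
  | self => exact hF
  | step _ _ _ _ _ hG => exact hG.2.2

/-- A stratum without points in `F` is residual. -/
theorem mem_residualArrangement {X Y : Set CP5} {F : Set RP5} (hF : IsClosed F)
    (hF' : F.Nonempty) (hY : IsStratum X F Y) (h : ∀ x ∈ F, toComplex x ∉ Y) :
    Y ∈ residualArrangement X F :=
  ⟨hY, fun _ _ hG hsub =>
    let ⟨x, hx⟩ := hG.nonempty hF'
    h x (hG.subset hF hx) (hsub ⟨x, hx, rfl⟩)⟩

/-! ### The coordinate planes in `Gr(2,4)`

The coordinate points span an octahedron, in which `i` and `i.rev` are opposite vertices. The planes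
spanned by its eight triangles are contained in `Gr(2,4)`. -/

/-- `t 0, t 1, t 2` are the vertices of a triangle of the octahedron. -/
def IsTriangle (t : Fin 3 → Fin 6) : Prop :=
  ∀ k, t k = k.castLE (by decide) ∨ t k = (k.castLE (by decide) : Fin 6).rev

section Triangle

variable {t : Fin 3 → Fin 6}

theorem IsTriangle.val (ht : IsTriangle t) (k : Fin 3) :
    (t k).val = k.val ∨ (t k).val = 5 - k.val := by
  rcases ht k with h | h <;> simp [h]

theorem IsTriangle.injective (ht : IsTriangle t) : Function.Injective t := fun k l hkl => by
  have hk := ht.val k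
  have hl := ht.val l
  rw [hkl] at hk
  omega

theorem IsTriangle.rev_ne (ht : IsTriangle t) (k l : Fin 3) : (t k).rev ≠ t l := fun hkl => by
  have hk := ht.val k
  have hl := ht.val l
  have h := congrArg Fin.val hkl
  rw [Fin.val_rev] at h
  obtain rfl : k = l := by omega
  omega

theorem IsTriangle.exists_eq (ht : IsTriangle t) (i : Fin 6) : ∃ k, i = t k ∨ i = (t k).rev := by
  obtain ⟨k, hk⟩ : ∃ k : Fin 3, i = k.castLE (by decide) ∨
      i = (k.castLE (by decide) : Fin 6).rev := by
    revert i
    decide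
  refine ⟨k, ?_⟩
  rcases ht k with h | h <;> rw [h] <;> simpa [or_comm] using hk

theorem IsTriangle.update_rev (ht : IsTriangle t) (k : Fin 3) :
    IsTriangle (Function.update t k (t k).rev) := fun l => by
  rcases eq_or_ne l k with rfl | hl
  · rw [Function.update_self, Fin.rev_eq_iff, Fin.rev_inj]
    exact (ht l).symm
  · rw [Function.update_of_ne hl]
    exact ht l

theorem IsTriangle.dotProduct_eq (ht : IsTriangle t) {R : Type*} [NonUnitalNonAssocSemiring R]
    (l w : Fin 6 → R) (hw : ∀ k, w (t k).rev = 0) : l ⬝ᵥ w = (l ∘ t) ⬝ᵥ (w ∘ t) := by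
  refine (Finset.sum_of_injOn t ht.injective.injOn (fun _ _ => Finset.mem_univ _) ?_
    fun _ _ => rfl).symm
  intro i _ hi
  obtain ⟨k, rfl | rfl⟩ := ht.exists_eq i
  · exact (hi ⟨k, by simp, rfl⟩).elim
  · rw [hw, mul_zero]

/-- The span of the coordinate vectors `t 0, t 1, t 2`. -/
def triangleSpace (t : Fin 3 → Fin 6) : Submodule ℂ (Fin 6 → ℂ) where
  carrier := {v | ∀ k, v (t k).rev = 0}
  add_mem' hv hw k := by simp [hv k, hw k]
  zero_mem' k := rfl
  smul_mem' c v hv k := by simp [hv k]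

/-- The zero space of a real linear form. -/
def formSpace (l : Fin 6 → ℝ) : Submodule ℂ (Fin 6 → ℂ) where
  carrier := {v | complexify l ⬝ᵥ v = 0}
  add_mem' hv hw := by
    simp only [Set.mem_ofPred_eq] at hv hw ⊢
    rw [dotProduct_add, hv, hw, add_zero]
  zero_mem' := dotProduct_zero _
  smul_mem' c v hv := by
    simp only [Set.mem_ofPred_eq] at hv ⊢
    rw [dotProduct_smul, hv, smul_zero]

theorem mem_triangleSpace {v : Fin 6 → ℂ} : v ∈ triangleSpace t ↔ ∀ k, v (t k).rev = 0 := Iff.rfl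

theorem mem_formSpace {l : Fin 6 → ℝ} {v : Fin 6 → ℂ} :
    v ∈ formSpace l ↔ complexify l ⬝ᵥ v = 0 := Iff.rfl

theorem complexify_single (i : Fin 6) : complexify (Pi.single i 1) = Pi.single i 1 := by
  ext j
  rcases eq_or_ne j i with rfl | h <;> simp [complexify, *]

theorem mem_formSpace_single {i : Fin 6} {v : Fin 6 → ℂ} :
    v ∈ formSpace (Pi.single i 1) ↔ v i = 0 := by
  rw [mem_formSpace, complexify_single, single_one_dotProduct]

theorem eval_pluecker (v : Fin 6 → ℂ) :
    MvPolynomial.eval v pluecker = v 0 * v 5 - v 1 * v 4 + v 3 * v 2 := by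
  simp [pluecker]

/-- On the zero set of the coordinates opposite to `t 0` and `t 2` the Plücker quadric splits. -/
theorem IsTriangle.pluecker_iff (ht : IsTriangle t) (v : Fin 6 → ℂ) (h₀ : v (t 0).rev = 0)
    (h₂ : v (t 2).rev = 0) :
    MvPolynomial.eval v pluecker = 0 ↔ v (t 1).rev = 0 ∨ v (t 1) = 0 := by
  have e₀ : v 0 * v 5 = 0 := by
    rcases ht 0 with h | h <;> rw [h] at h₀
    · exact mul_eq_zero_of_right _ h₀
    · exact mul_eq_zero_of_left h₀ _
  have e₂ : v 3 * v 2 = 0 := by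
    rcases ht 2 with h | h <;> rw [h] at h₂
    · exact mul_eq_zero_of_left h₂ _
    · exact mul_eq_zero_of_right _ h₂
  rw [eval_pluecker, e₀, e₂, zero_sub, add_zero, neg_eq_zero, mul_eq_zero]
  rcases ht 1 with h | h <;> rw [h]
  · exact or_comm
  · exact Iff.rfl

theorem projSet_triangleSpace_subset (ht : IsTriangle t) : projSet (triangleSpace t) ⊆ Gr :=
  fun x hx => (ht.pluecker_iff x.rep (hx 0) (hx 2)).2 (.inl (hx 1))

variable {h : Fin 2 → Fin 6 → ℝ}

theorem IsPositiveHexahedron.isStratum_facet (H : IsPositiveHexahedron h) {i : Fin 6 ⊕ Fin 2}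
    (h₁ : i ≠ Sum.inl 1) (h₄ : i ≠ Sum.inl 4) :
    IsStratum Gr (hexahedron h) (Gr ∩ projSet (formSpace (forms h i))) :=
  .facet _ (by rw [H.facets]; exact ⟨i, ⟨h₁, h₄⟩, rfl⟩)

/-- The coordinates opposite to `t 0` and `t 2` are never `p₁₃` or `p₂₄`, so they define facets. On
their common zero set the Plücker quadric becomes `p₁₃p₂₄ = 0`, a union of two triangle planes. -/
theorem IsPositiveHexahedron.isStratum_triangle (H : IsPositiveHexahedron h) (ht : IsTriangle t) :
    IsStratum Gr (hexahedron h) (projSet (triangleSpace t)) := by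
  have key (k : Fin 3) (hk : k ≠ 1) :
      Sum.inl (β := Fin 2) (t k).rev ≠ Sum.inl 1 ∧ Sum.inl (β := Fin 2) (t k).rev ≠ Sum.inl 4 := by
    have := ht.val k
    simp only [ne_eq, Sum.inl.injEq, Fin.ext_iff, Fin.val_rev] at hk ⊢
    omega
  refine .inter _ _ _ (H.isStratum_facet (key 0 (by decide)).1 (key 0 (by decide)).2)
    (H.isStratum_facet (key 2 (by decide)).1 (key 2 (by decide)).2) ?_
  have hle : ¬ triangleSpace t ≤ triangleSpace (Function.update t 1 (t 1).rev) := fun hle => by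
    have hm : (Pi.single (t 1) 1 : Fin 6 → ℂ) ∈ triangleSpace t := fun k => by
      simp [ht.rev_ne k 1]
    simpa using hle hm 1
  convert isComponent_projSet_union hle using 1
  ext x
  have hx : x ∈ Gr ↔ MvPolynomial.eval x.rep pluecker = 0 := Iff.rfl
  simp only [Set.mem_inter_iff, Set.mem_union, hx, projSet, Set.mem_ofPred_eq, forms,
    Sum.elim_inl, mem_formSpace_single, mem_triangleSpace, Fin.forall_fin_succ,
    Fin.succ_zero_eq_one, Fin.succ_one_eq_two, IsEmpty.forall_iff, and_true, Fin.rev_rev,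
    Function.update_self, ne_eq, Fin.zero_ne_one, not_false_eq_true, Function.update_of_ne,
    Fin.reduceEq]
  have := ht.pluecker_iff x.rep
  tauto

/-! ### The five lines in a coordinate plane -/

/-- The forms that do not vanish on the plane spanned by the triangle `t`. -/
def lineIndex (t : Fin 3 → Fin 6) : Fin 5 → Fin 6 ⊕ Fin 2 :=
  ![Sum.inl (t 0), Sum.inl (t 1), Sum.inl (t 2), Sum.inr 0, Sum.inr 1]

/-- The five lines cut out in the plane spanned by the triangle `t`. -/
def lines (h : Fin 2 → Fin 6 → ℝ) (t : Fin 3 → Fin 6) (i : Fin 5) : Fin 3 → ℝ :=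
  forms h (lineIndex t i) ∘ t

/-- The linear space of the line `lines h t i`. -/
def lineSpace (h : Fin 2 → Fin 6 → ℝ) (t : Fin 3 → Fin 6) (i : Fin 5) :
    Submodule ℂ (Fin 6 → ℂ) :=
  triangleSpace t ⊓ formSpace (forms h (lineIndex t i))

/-- The inclusion of the coordinate plane of a triangle. -/
def embed (t : Fin 3 → Fin 6) : (Fin 3 → ℝ) →ₗ[ℝ] (Fin 6 → ℝ) :=
  Function.ExtendByZero.linearMap ℝ t

theorem IsTriangle.embed_apply (ht : IsTriangle t) (y : Fin 3 → ℝ) (k : Fin 3) :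
    embed t y (t k) = y k := ht.injective.extend_apply y _ k

theorem IsTriangle.embed_rev (ht : IsTriangle t) (y : Fin 3 → ℝ) (k : Fin 3) :
    embed t y (t k).rev = 0 :=
  Function.extend_apply' y _ _ fun ⟨l, hl⟩ => ht.rev_ne k l hl.symm

theorem IsTriangle.embed_single (ht : IsTriangle t) (k : Fin 3) :
    embed t (Pi.single k 1) = Pi.single (t k) 1 := by
  ext i
  obtain ⟨l, rfl | rfl⟩ := ht.exists_eq i
  · simp only [ht.embed_apply, Pi.single_apply, ht.injective.eq_iff]
  · rw [ht.embed_rev, Pi.single_eq_of_ne (ht.rev_ne l k)]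

theorem complexify_dotProduct (l w : Fin 6 → ℝ) :
    complexify l ⬝ᵥ complexify w = ((l ⬝ᵥ w : ℝ) : ℂ) := by
  simp [complexify, dotProduct]

theorem complexify_mem_lineSpace (ht : IsTriangle t) {w : Fin 6 → ℝ} {i : Fin 5} :
    complexify w ∈ lineSpace h t i ↔ (∀ k, w (t k).rev = 0) ∧ lines h t i ⬝ᵥ (w ∘ t) = 0 := by
  have : complexify w ∈ triangleSpace t ↔ ∀ k, w (t k).rev = 0 :=
    forall_congr' fun k => Complex.ofReal_eq_zero
  rw [lineSpace, Submodule.mem_inf, this, mem_formSpace, complexify_dotProduct,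
    Complex.ofReal_eq_zero]
  refine and_congr_right fun hw => ?_
  rw [ht.dotProduct_eq _ w hw, lines]

theorem complexify_embed_mem_lineSpace (ht : IsTriangle t) {y : Fin 3 → ℝ} {i : Fin 5} :
    complexify (embed t y) ∈ lineSpace h t i ↔ lines h t i ⬝ᵥ y = 0 := by
  rw [complexify_mem_lineSpace ht, and_iff_right (ht.embed_rev y)]
  congr! 2
  ext k
  exact ht.embed_apply y k

theorem complexify_embed_ne_zero (ht : IsTriangle t) {y : Fin 3 → ℝ} (hy : y ≠ 0) :
    complexify (embed t y) ≠ 0 := fun h0 => hy <| by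
  ext k
  rw [← ht.embed_apply y k, complexify_injective (h0.trans (map_zero _).symm)]
  rfl

theorem cross_ne_zero (hL : InGeneralPosition (lines h t)) {i j : Fin 5} (hij : i ≠ j) :
    lines h t i ⨯₃ lines h t j ≠ 0 := by
  obtain ⟨k, hki, hkj⟩ : ∃ k : Fin 5, k ≠ i ∧ k ≠ j := by
    clear hij
    revert i j
    decide
  intro h0
  apply hL k i j hki hkj hij
  rw [triple, h0, dotProduct_zero]

/-- Since `p₁₃` and `p₂₄` give no facets, each coordinate line is obtained as the intersection with
the plane of the adjacent triangle, one vertex being replaced by its opposite. The other two lines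
are cut out by the facets of `h₁`, `h₂`. -/
theorem IsPositiveHexahedron.isStratum_line (H : IsPositiveHexahedron h) (ht : IsTriangle t)
    (i : Fin 5) (hne : lineSpace h t i ≠ ⊥) :
    IsStratum Gr (hexahedron h) (projSet (lineSpace h t i)) := by
  have hP := H.isStratum_triangle ht
  have coord (k : Fin 3) (hk : lineIndex t i = Sum.inl (t k)) :
      IsStratum Gr (hexahedron h) (projSet (lineSpace h t i)) := by
    have heq : lineSpace h t i =
        triangleSpace t ⊓ triangleSpace (Function.update t k (t k).rev) := by
      ext v
      rw [lineSpace, hk, forms, Sum.elim_inl, Submodule.mem_inf, Submodule.mem_inf,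
        mem_formSpace_single]
      refine and_congr_right fun hv => ⟨fun h0 l => ?_, fun h0 => ?_⟩
      · rcases eq_or_ne l k with rfl | hl
        · simpa using h0
        · simpa [hl] using hv l
      · simpa using h0 k
    rw [heq] at hne ⊢
    exact hP.projSet_inf (H.isStratum_triangle (ht.update_rev k)) hne
  have cut (k : Fin 2) (hk : lineIndex t i = Sum.inr k) :
      IsStratum Gr (hexahedron h) (projSet (lineSpace h t i)) := by
    refine .inter _ _ _ hP (H.isStratum_facet (i := Sum.inr k) (by simp) (by simp)) ?_
    convert isComponent_projSet hne using 1
    rw [lineSpace, hk, projSet_inf, ← Set.inter_assoc,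
      Set.inter_eq_left.2 (projSet_triangleSpace_subset ht)]
  fin_cases i
  exacts [coord 0 rfl, coord 1 rfl, coord 2 rfl, cut 0 rfl, cut 1 rfl]

theorem IsPositiveHexahedron.isStratum_point (H : IsPositiveHexahedron h) (ht : IsTriangle t)
    (hL : InGeneralPosition (lines h t)) {i j : Fin 5} (hij : i ≠ j) :
    IsStratum Gr (hexahedron h) (projSet (lineSpace h t i ⊓ lineSpace h t j)) := by
  have hne := complexify_embed_ne_zero ht (cross_ne_zero hL hij)
  have hi : complexify (embed t (lines h t i ⨯₃ lines h t j)) ∈ lineSpace h t i :=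
    (complexify_embed_mem_lineSpace ht).2 (dot_self_cross _ _)
  have hj : complexify (embed t (lines h t i ⨯₃ lines h t j)) ∈ lineSpace h t j :=
    (complexify_embed_mem_lineSpace ht).2 (dot_cross_self _ _)
  exact (H.isStratum_line ht i (Submodule.ne_bot_iff _ |>.2 ⟨_, hi, hne⟩)).projSet_inf
    (H.isStratum_line ht j (Submodule.ne_bot_iff _ |>.2 ⟨_, hj, hne⟩))
    (Submodule.ne_bot_iff _ |>.2 ⟨_, ⟨hi, hj⟩, hne⟩)

theorem IsPositiveHexahedron.nonempty (H : IsPositiveHexahedron h) : (hexahedron h).Nonempty := by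
  have : Gr ∩ hyperplane (forms h (Sum.inl 0)) ∈ facetClosures Gr (hexahedron h) := by
    rw [H.facets]
    exact ⟨Sum.inl 0, ⟨by simp, by simp⟩, rfl⟩
  obtain ⟨C, G, hG, -⟩ := this
  exact hG.nonempty_left

/-- Vectors orthogonal to `u` and `v` are proportional to `u ⨯ v`. -/
theorem exists_cross_eq_smul {u v w : Fin 3 → ℝ} (hw : w ≠ 0) (hu : u ⬝ᵥ w = 0)
    (hv : v ⬝ᵥ w = 0) : ∃ c : ℝ, u ⨯₃ v = c • w := by
  obtain ⟨k, hk⟩ := Function.ne_iff.1 hw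
  have h (l : Fin 3) : (u ⨯₃ v) l * w k = (u ⨯₃ v) k * w l := by
    simp only [dotProduct, Fin.sum_univ_three] at hu hv
    fin_cases k <;> fin_cases l <;> simp [cross_apply] <;>
      first
        | ring1
        | linear_combination u 0 * hv - v 0 * hu
        | linear_combination u 1 * hv - v 1 * hu
        | linear_combination u 2 * hv - v 2 * hu
        | linear_combination v 0 * hu - u 0 * hv
        | linear_combination v 1 * hu - u 1 * hv
        | linear_combination v 2 * hu - u 2 * hv
  refine ⟨(u ⨯₃ v) k / w k, ?_⟩
  ext l
  rw [Pi.smul_apply, smul_eq_mul, div_mul_eq_mul_div, eq_div_iff hk, h]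

/-- An adjoint vanishes at the intersection points that are not in the polytope. -/
theorem IsAdjoint.eval_point_eq_zero {a : MvPolynomial (Fin 6) ℂ} (ha : IsAdjoint h a)
    (H : IsPositiveHexahedron h) (ht : IsTriangle t) (hL : InGeneralPosition (lines h t))
    {i j : Fin 5} (hij : i ≠ j) (hdead : ¬ IsAlive (lines h t) i j) :
    MvPolynomial.eval (complexify (embed t (lines h t i ⨯₃ lines h t j))) a = 0 := by
  have hne := complexify_embed_ne_zero ht (cross_ne_zero hL hij)
  rw [← vanishes_mk ha.1 hne]
  refine ha.2.1 _ (mem_residualArrangement (isClosed_hexahedron h) H.nonempty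
    (H.isStratum_point ht hL hij) fun x hx hxY => hdead ?_) _ ((mk_mem_projSet hne).2
      ⟨(complexify_embed_mem_lineSpace ht).2 (dot_self_cross _ _),
        (complexify_embed_mem_lineSpace ht).2 (dot_cross_self _ _)⟩)
  rw [toComplex_mem_projSet, Submodule.mem_inf, complexify_mem_lineSpace ht,
    complexify_mem_lineSpace ht] at hxY
  obtain ⟨⟨hw, hi⟩, -, hj⟩ := hxY
  have hw0 : x.rep ∘ t ≠ 0 := fun h0 => x.rep_nonzero <| by
    ext l
    obtain ⟨k, rfl | rfl⟩ := ht.exists_eq l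
    · exact congrFun h0 k
    · exact hw k
  -- A point of `S` in this stratum is proportional to the cross product. The factor enters each
  -- product of two forms as a square, so the inequalities of the polytope become aliveness.
  obtain ⟨c, hc⟩ := exists_cross_eq_smul hw0 hi hj
  intro k l
  have hkl := hx.1 (lineIndex t k) (lineIndex t l)
  rw [ht.dotProduct_eq _ _ hw, ht.dotProduct_eq _ _ hw] at hkl
  rw [triple, triple, hc, dotProduct_smul, dotProduct_smul, smul_eq_mul, smul_eq_mul,
    mul_mul_mul_comm]
  exact mul_nonneg (mul_self_nonneg c) hkl

/-- Five lines in a coordinate plane are in general position if no coefficient and no minor of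
`(h₁, h₂)` vanishes. -/
theorem inGeneralPosition_lines (ht : IsTriangle t) (hc : ∀ k i, h k i ≠ 0)
    (hm : ∀ i j, i ≠ j → h 0 i * h 1 j - h 0 j * h 1 i ≠ 0) :
    InGeneralPosition (lines h t) := by
  have e (k l : Fin 3) : (Pi.single (t k) 1 : Fin 6 → ℝ) (t l) = if l = k then 1 else 0 := by
    rw [Pi.single_apply]
    simp only [ht.injective.eq_iff]
  have c (k : Fin 2) (l : Fin 3) := hc k (t l)
  have m₀ := hm (t 1) (t 2) (ht.injective.ne (by decide))
  have m₁ := hm (t 0) (t 2) (ht.injective.ne (by decide))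
  have m₂ := hm (t 0) (t 1) (ht.injective.ne (by decide))
  -- Up to sign, a triple product is `1` for three coordinate lines, a coefficient of `h` for two,
  -- and a minor for one.
  intro i j k hij hik hjk
  fin_cases i <;> fin_cases j <;> first | exact (hij rfl).elim | skip
  all_goals fin_cases k <;> first | exact (hik rfl).elim | exact (hjk rfl).elim | skip
  all_goals
    simp [triple_eq, lines, lineIndex, forms, e]
    first
      | done
      | exact c _ _
      | exact fun h0 => m₀ (by linear_combination h0)
      | exact fun h0 => m₀ (by linear_combination -h0)
      | exact fun h0 => m₁ (by linear_combination h0)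
      | exact fun h0 => m₁ (by linear_combination -h0)
      | exact fun h0 => m₂ (by linear_combination h0)
      | exact fun h0 => m₂ (by linear_combination -h0)

end Triangle

/-! ### Quadratic forms -/

theorem exists_coefficients {a : MvPolynomial (Fin 6) ℂ} (ha : a.IsHomogeneous 2) :
    ∃ c : Fin 6 → Fin 6 → ℂ, ∀ x, MvPolynomial.eval x a = ∑ i, ∑ j, c i j * (x i * x j) := by
  have hmem : a ∈ Submodule.span ℂ (Set.range (MvPolynomial.X (σ := Fin 6) (R := ℂ)) *
      Set.range (MvPolynomial.X (σ := Fin 6) (R := ℂ))) := by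
    rw [← Submodule.span_mul_span, ← pow_two, ← MvPolynomial.homogeneousSubmodule_one_eq_span_X,
      MvPolynomial.homogeneousSubmodule_one_pow]
    exact ha
  clear ha
  induction hmem using Submodule.span_induction with
  | mem f hf =>
    obtain ⟨_, ⟨i, rfl⟩, _, ⟨j, rfl⟩, rfl⟩ := hf
    refine ⟨fun k l => if k = i then if l = j then 1 else 0 else 0, fun x => ?_⟩
    simp [ite_mul]
  | zero => exact ⟨0, fun x => by simp⟩
  | add f g _ _ hf hg =>
    obtain ⟨c, hc⟩ := hf
    obtain ⟨d, hd⟩ := hg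
    exact ⟨c + d, fun x => by simp [hc, hd, add_mul, Finset.sum_add_distrib]⟩
  | smul r f _ hf =>
    obtain ⟨c, hc⟩ := hf
    exact ⟨r • c, fun x => by simp [hc, Finset.mul_sum, mul_assoc]⟩

/-- The lines and their intersection points are real, so the conic argument needs only
complex-valued quadratic maps on real vectors. -/
theorem exists_quadraticMap {a : MvPolynomial (Fin 6) ℂ} (ha : a.IsHomogeneous 2) :
    ∃ Q : QuadraticMap ℝ (Fin 6 → ℝ) ℂ, ∀ x, Q x = MvPolynomial.eval (complexify x) a := by
  obtain ⟨c, hc⟩ := exists_coefficients ha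
  let f (i : Fin 6) : (Fin 6 → ℝ) →ₗ[ℝ] ℂ := Algebra.linearMap ℝ ℂ ∘ₗ LinearMap.proj i
  refine ⟨∑ i, ∑ j, c i j • QuadraticMap.linMulLin (f i) (f j), fun x => ?_⟩
  simp [hc, f, complexify]

theorem eval_single_add_single {a : MvPolynomial (Fin 6) ℂ} {c : Fin 6 → Fin 6 → ℂ}
    (hc : ∀ x, MvPolynomial.eval x a = ∑ i, ∑ j, c i j * (x i * x j)) (i j : Fin 6) :
    MvPolynomial.eval (Pi.single i 1 + Pi.single j 1) a = c i i + c i j + c j i + c j j := by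
  rw [hc]
  simp [Pi.single_apply, mul_add, Finset.sum_add_distrib]
  ring

/-- A quadratic form that vanishes on the edges of the octahedron is a combination of
`p₁₂ p₃₄`, `p₁₃ p₂₄` and `p₁₄ p₂₃`; two more conditions make it a multiple of the Plücker
quadric. -/
theorem mem_span_pluecker {a : MvPolynomial (Fin 6) ℂ} (ha : a.IsHomogeneous 2)
    (h : ∀ i j : Fin 6, j ≠ i.rev → MvPolynomial.eval (Pi.single i 1 + Pi.single j 1) a = 0)
    (h₁ : MvPolynomial.eval (Pi.single 0 1 + Pi.single 5 1) a
      + MvPolynomial.eval (Pi.single 1 1 + Pi.single 4 1) a = 0)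
    (h₂ : MvPolynomial.eval (Pi.single 0 1 + Pi.single 5 1) a
      - MvPolynomial.eval (Pi.single 2 1 + Pi.single 3 1) a = 0) :
    a ∈ Ideal.span {pluecker} := by
  obtain ⟨c, hc⟩ := exists_coefficients ha
  simp only [eval_single_add_single hc] at h h₁ h₂
  have hd (i : Fin 6) : c i i = 0 := by
    -- The value at twice a coordinate vector is four times the diagonal coefficient.
    have := h i i (by revert i; decide)
    linear_combination this / 4
  simp only [hd, zero_add, add_zero] at h h₁ h₂
  -- The multiplier is the coefficient of `p₁₂p₃₄`; `h₁` and `h₂` match the other two coefficients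
  -- to it.
  refine Ideal.mem_span_singleton'.2 ⟨MvPolynomial.C (c 0 5 + c 5 0), ?_⟩
  refine MvPolynomial.funext fun x => ?_
  have hx : 2 * MvPolynomial.eval x a = ∑ i, (c i i.rev + c i.rev i) * (x i * x i.rev) := by
    have hswap : ∑ i, ∑ j, c i j * (x i * x j) = ∑ i, ∑ j, c j i * (x i * x j) := by
      rw [Finset.sum_comm]
      exact Finset.sum_congr rfl fun i _ => Finset.sum_congr rfl fun j _ => by ring
    rw [two_mul, hc]
    nth_rewrite 2 [hswap]
    simp only [← Finset.sum_add_distrib, ← add_mul]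
    refine Finset.sum_congr rfl fun i _ => Finset.sum_eq_single _ (fun j _ hj => ?_) (by simp)
    rw [h i j hj, zero_mul]
  rw [Fin.sum_univ_six] at hx
  simp only [map_mul, MvPolynomial.eval_C, eval_pluecker]
  simp only [show Fin.rev (0 : Fin 6) = 5 from rfl, show Fin.rev (1 : Fin 6) = 4 from rfl,
    show Fin.rev (2 : Fin 6) = 3 from rfl, show Fin.rev (3 : Fin 6) = 2 from rfl,
    show Fin.rev (4 : Fin 6) = 1 from rfl, show Fin.rev (5 : Fin 6) = 0 from rfl] at hx
  linear_combination -hx / 2 - x 1 * x 4 * h₁ + x 2 * x 3 * h₂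

/-! ### The bound -/

/-- Four triangles of the octahedron that together contain each edge. -/
def edgeTriangles : Fin 4 → Fin 3 → Fin 6 := ![![0, 1, 2], ![0, 4, 3], ![5, 1, 3], ![5, 4, 2]]

theorem isTriangle_edgeTriangles (s : Fin 4) : IsTriangle (edgeTriangles s) := by
  revert s
  unfold IsTriangle
  decide

theorem exists_edgeTriangle (i j : Fin 6) (hij : j ≠ i.rev) :
    ∃ s k l, edgeTriangles s k = i ∧ edgeTriangles s l = j := by
  revert i j
  decide

theorem complexify_add_single (i j : Fin 6) :
    complexify (Pi.single i 1 + Pi.single j 1) = Pi.single i 1 + Pi.single j 1 := by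
  rw [map_add, complexify_single, complexify_single]

theorem card_le_six {h : Fin 2 → Fin 6 → ℝ} (H : IsPositiveHexahedron h)
    (hL : ∀ t, IsTriangle t → InGeneralPosition (lines h t)) {n : ℕ}
    {a : Fin n → MvPolynomial (Fin 6) ℂ} (ha : ∀ k, IsAdjoint h (a k))
    (hli : LinearIndependent ℂ (fun k => Ideal.Quotient.mk (Ideal.span {pluecker}) (a k))) :
    n ≤ 6 := by
  choose p hp using fun s =>
    exists_point_determining_conic (hL _ (isTriangle_edgeTriangles s))
  let ev (x : Fin 6 → ℂ) : MvPolynomial (Fin 6) ℂ →ₗ[ℂ] ℂ := (MvPolynomial.aeval x).toLinearMap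
  have hev (x : Fin 6 → ℂ) (f : MvPolynomial (Fin 6) ℂ) : ev x f = MvPolynomial.eval x f := by
    simp [ev, MvPolynomial.aeval_eq_eval]
  let e (i j : Fin 6) := ev (Pi.single i 1 + Pi.single j 1)
  -- One value for each of the four planes, and two for the products of opposite coordinates modulo
  -- the Plücker quadric.
  let Ψ : MvPolynomial (Fin 6) ℂ →ₗ[ℂ] (Fin 4 → ℂ) × ℂ × ℂ :=
    (LinearMap.pi fun s => ev (complexify (embed (edgeTriangles s) (p s)))).prod
      ((e 0 5 + e 1 4).prod (e 0 5 - e 2 3))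
  let A : (Fin n → ℂ) →ₗ[ℂ] MvPolynomial (Fin 6) ℂ := Fintype.linearCombination ℂ a
  have hA (z : Fin n → ℂ) : A z = ∑ k, z k • a k := rfl
  have hinj : Function.Injective (Ψ ∘ₗ A) := by
    rw [injective_iff_map_eq_zero]
    intro z hz
    -- A combination of adjoints may contain `Gr(2,4)` and fail to be an adjoint, but homogeneity
    -- and vanishing at the residual points are linear conditions.
    have hhom : (A z).IsHomogeneous 2 := by
      rw [hA]
      exact (MvPolynomial.homogeneousSubmodule (Fin 6) ℂ 2).sum_mem fun k _ =>
        Submodule.smul_mem _ _ (ha k).1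
    have hz₀ (s : Fin 4) : ev (complexify (embed (edgeTriangles s) (p s))) (A z) = 0 :=
      congrArg (fun w : (Fin 4 → ℂ) × ℂ × ℂ => w.1 s) hz
    have hz₁ : e 0 5 (A z) + e 1 4 (A z) = 0 := congrArg (fun w => w.2.1) hz
    have hz₂ : e 0 5 (A z) - e 2 3 (A z) = 0 := congrArg (fun w => w.2.2) hz
    simp only [e, hev] at hz₀ hz₁ hz₂
    obtain ⟨Q, hQ⟩ := exists_quadraticMap hhom
    have hzero (s : Fin 4) (y : Fin 3 → ℝ) :
        MvPolynomial.eval (complexify (embed (edgeTriangles s) y)) (A z) = 0 := by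
      have ht := isTriangle_edgeTriangles s
      rw [← hQ]
      refine hp s (Q.comp (embed (edgeTriangles s))) (fun i j hij hdead => ?_) ?_ y
      · rw [QuadraticMap.comp_apply, hQ, hA, map_sum]
        refine Finset.sum_eq_zero fun k _ => ?_
        rw [MvPolynomial.smul_eval, (ha k).eval_point_eq_zero H ht (hL _ ht) hij hdead, mul_zero]
      · rw [QuadraticMap.comp_apply, hQ]
        exact hz₀ s
    have hmem : A z ∈ Ideal.span {pluecker} := by
      refine mem_span_pluecker hhom (fun i j hij => ?_) hz₁ hz₂
      obtain ⟨s, k, l, rfl, rfl⟩ := exists_edgeTriangle i j hij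
      have ht := isTriangle_edgeTriangles s
      rw [← complexify_add_single, ← ht.embed_single, ← ht.embed_single, ← map_add]
      exact hzero s _
    rw [← Ideal.Quotient.eq_zero_iff_mem, hA, map_sum] at hmem
    ext k
    exact Fintype.linearIndependent_iff.1 hli z hmem k
  simpa using LinearMap.finrank_le_finrank_of_injective hinj

/-- The product of the coefficients of `(h₁, h₂)` and of its minors. -/
def genericPolynomial : MvPolynomial (Fin 2 × Fin 6) ℝ :=
  (∏ ki, MvPolynomial.X ki) * ∏ ij ∈ (Finset.univ : Finset (Fin 6)).offDiag,
    (MvPolynomial.X (0, ij.1) * MvPolynomial.X (1, ij.2)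
      - MvPolynomial.X (0, ij.2) * MvPolynomial.X (1, ij.1))

theorem genericPolynomial_ne_zero : genericPolynomial ≠ 0 := by
  refine mul_ne_zero (Finset.prod_ne_zero_iff.2 fun ki _ => MvPolynomial.X_ne_zero ki)
    (Finset.prod_ne_zero_iff.2 fun ij hij h0 => ?_)
  have hne : ij.1 ≠ ij.2 := (Finset.mem_offDiag.1 hij).2.2
  -- Taking coordinate vectors for `h₁` and `h₂` gives this minor the value `1`.
  have := congrArg (MvPolynomial.eval
    fun ki => if ki = (0, ij.1) ∨ ki = (1, ij.2) then (1 : ℝ) else 0) h0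
  simp [hne] at this

theorem inGeneralPosition_of_generic {h : Fin 2 → Fin 6 → ℝ}
    (hh : MvPolynomial.eval (fun ij => h ij.1 ij.2) genericPolynomial ≠ 0)
    (t : Fin 3 → Fin 6) (ht : IsTriangle t) : InGeneralPosition (lines h t) := by
  simp only [genericPolynomial, map_mul, map_prod, map_sub, MvPolynomial.eval_X,
    mul_ne_zero_iff, Finset.prod_ne_zero_iff] at hh
  exact inGeneralPosition_lines ht (fun k i => hh.1 (k, i) (Finset.mem_univ _))
    fun i j hij => hh.2 (i, j) (by simp [hij])

end PosHex

end

theorem proposition4p4 :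
    ∃ Φ : MvPolynomial (Fin 2 × Fin 6) ℝ, Φ ≠ 0 ∧
      ∀ h : Fin 2 → Fin 6 → ℝ, MvPolynomial.eval (fun ij => h ij.1 ij.2) Φ ≠ 0 →
        PosHex.IsPositiveHexahedron h →
        ∀ (n : ℕ) (a : Fin n → MvPolynomial (Fin 6) ℂ),
          (∀ k, PosHex.IsAdjoint h (a k)) →
          LinearIndependent ℂ
            (fun k => Ideal.Quotient.mk (Ideal.span {PosHex.pluecker}) (a k)) →
          n ≤ 6 :=
  ⟨PosHex.genericPolynomial, PosHex.genericPolynomial_ne_zero, fun _ hΦ H _ _ ha hli =>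
    PosHex.card_le_six H (PosHex.inGeneralPosition_of_generic hΦ) ha hli⟩
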